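/- For positive integers $a$ and $n$ with $a\ge 2$ write $\zeta(\{a\}^n)=\sum_{1\le k_1<k_2<\cdots<k_n} k_1^{-a}k_2^{-a}\cdots k_n^{-a}$ for the multiple zeta value of depth $n$ with all arguments equal to $a$ (a convergent series). Let $m$ and $n$ be positive integers with $m\ge 3$ odd, and let $w=e^{2\pi i/m}$. Then $$ \zeta(\{2m\}^n)=\frac{2\,(2\pi)^{2mn}}{(2mn+m)!}\sum_{r=1}^{(m-1)/2}(-1)^{r-1}\sum_{0\le j_1<j_2<\cdots<j_r\le m-1}\bigl(w^{j_1}+w^{j_2}+\cdots+w^{j_r}\bigr)^{2mn+m}. $$ -/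

import Mathlib

noncomputable section

/-- The summation range of a multiple zeta value of depth `r`: all tuples of integers
`1 ≤ k₁ < k₂ < ⋯ < kᵣ`. -/
def MZVIndex (r : ℕ) : Type :=
  {k : Fin r → ℕ // (∀ i, 1 ≤ k i) ∧ StrictMono k}

/-- The summand `k₁^(-α₁) k₂^(-α₂) ⋯ kᵣ^(-αᵣ)`. -/
def mzvTerm {r : ℕ} (α : Fin r → ℕ) (k : MZVIndex r) : ℝ :=
  ∏ i, ((k.1 i : ℝ) ^ α i)⁻¹

/-- The multiple zeta value `ζ(α₁, …, αᵣ) = ∑_{1 ≤ k₁ < ⋯ < kᵣ} k₁^(-α₁) ⋯ kᵣ^(-αᵣ)`. -/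
def multiZeta {r : ℕ} (α : Fin r → ℕ) : ℝ :=
  ∑' k : MZVIndex r, mzvTerm α k

end

open Filter Topology Finset

/-! Expand `∏ j, sin (π w^j x)` in powers of `x` in two ways. Euler's product, with the factors
regrouped over the `m`-th roots of unity, gives `(πx)^m ∏_{k≥1} (1 - x^(2m)/k^(2m))`, whose
coefficients are the zeta values up to sign (`prod_sin_eq_mul_tprod`). Writing each sine by
exponentials and multiplying out gives a signed sum over subsets of the roots
(`prod_sin_eq_sum_exp`). Comparing coefficients of `x^(2mn+m)` yields a sum over all subsets. As the
roots sum to zero and `m` is odd, complementary subsets contribute equally, which leaves twice the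
sizes up to `(m-1)/2`. -/

/-- The elementary symmetric function of degree `n` of the family `b`, as an infinite sum. -/
noncomputable def esymmTsum {ι R : Type*} [CommSemiring R] [TopologicalSpace R] (b : ι → R) (n : ℕ) : R :=
  ∑' s : (Finset.card : Finset ι → ℕ) ⁻¹' {n}, ∏ i ∈ s.1, b i

lemma hasSum_pow_mul_esymmTsum {b : ℕ → ℂ} (hb : Summable fun i => ‖b i‖) (t : ℂ) :
    HasSum (fun n => t ^ n * esymmTsum b n) (∏' i, (1 + t * b i)) := by
  have hs : Summable fun s : Finset ℕ => ∏ i ∈ s, (t * b i) :=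
    summable_finsetProd_of_summable_norm (by simpa using hb.mul_left ‖t‖)
  rw [tprod_one_add hs]
  have h := hs.hasSum.tsum_fiberwise (Finset.card : Finset ℕ → ℕ)
  refine h.congr_fun fun n => ?_
  rw [esymmTsum, ← tsum_mul_left]
  refine tsum_congr fun s => ?_
  have : s.1.card = n := s.2
  rw [prod_mul_distrib, prod_const, this]

lemma tendsto_prod_one_add_mul {b : ℕ → ℂ} (hb : Summable fun i => ‖b i‖) (t : ℂ) :
    Tendsto (fun N => ∏ i ∈ range N, (1 + t * b i)) atTop (𝓝 (∏' i, (1 + t * b i))) := by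
  have hs : Summable fun s : Finset ℕ => ∏ i ∈ s, (t * b i) :=
    summable_finsetProd_of_summable_norm (by simpa using hb.mul_left ‖t‖)
  exact (multipliable_one_add_of_summable_prod hs).hasProd.tendsto_prod_nat

/-- The finite set of entries of an index of a multiple zeta value. -/
def MZVIndex.toFinset {r : ℕ} (k : MZVIndex r) : Finset ℕ := univ.image k.1

lemma MZVIndex.toFinset_injective {r : ℕ} : Function.Injective (toFinset (r := r)) := by
  intro k l h
  refine Subtype.ext ((k.2.2.range_inj l.2.2).1 ?_)
  simpa [toFinset] using congrArg (fun s : Finset ℕ => (s : Set ℕ)) h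

lemma MZVIndex.card_toFinset {r : ℕ} (k : MZVIndex r) : k.toFinset.card = r := by
  simp [toFinset, card_image_of_injective _ k.2.2.injective]

lemma MZVIndex.exists_toFinset_eq {s : Finset ℕ} (hs : 0 ∉ s) :
    ∃ k : MZVIndex s.card, k.toFinset = s := by
  refine ⟨⟨s.orderEmbOfFin rfl, fun i => ?_, (s.orderEmbOfFin rfl).strictMono⟩,
    s.image_orderEmbOfFin_univ rfl⟩
  have := s.orderEmbOfFin_mem rfl i
  exact Nat.one_le_iff_ne_zero.2 fun h => hs (h ▸ this)

lemma mzvTerm_const {r : ℕ} (a : ℕ) (k : MZVIndex r) :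
    mzvTerm (fun _ => a) k = ∏ i ∈ k.toFinset, ((i : ℝ) ^ a)⁻¹ := by
  rw [mzvTerm, MZVIndex.toFinset, prod_image (fun _ _ _ _ h => k.2.2.injective h)]

lemma summable_inv_pow_norm {a : ℕ} (ha : 2 ≤ a) : Summable fun i : ℕ => ‖((i : ℝ) ^ a)⁻¹‖ := by
  simpa using Real.summable_nat_pow_inv.2 (by omega : 1 < a)

lemma summable_mzvTerm_const {a : ℕ} (ha : 2 ≤ a) (n : ℕ) :
    Summable (mzvTerm (fun _ : Fin n => a)) := by
  have hs : Summable fun s : Finset ℕ => ∏ i ∈ s, ((i : ℝ) ^ a)⁻¹ :=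
    summable_finsetProd_of_summable_norm (summable_inv_pow_norm ha)
  exact (hs.comp_injective MZVIndex.toFinset_injective).congr fun k => (mzvTerm_const a k).symm

lemma multiZeta_const {a : ℕ} (ha : a ≠ 0) (n : ℕ) :
    multiZeta (fun _ : Fin n => a) = esymmTsum (fun i : ℕ => ((i : ℝ) ^ a)⁻¹) n := by
  let φ : MZVIndex n → (Finset.card : Finset ℕ → ℕ) ⁻¹' {n} :=
    fun k => ⟨k.toFinset, k.card_toFinset⟩
  have hφ : Function.Injective φ := fun k l h =>
    MZVIndex.toFinset_injective (congrArg Subtype.val h)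
  rw [multiZeta, esymmTsum, ← hφ.tsum_eq]
  · exact tsum_congr fun k => mzvTerm_const a k
  · rintro ⟨s, rfl⟩ h
    -- The index `0` is harmless: its factor is `(0 ^ a)⁻¹ = 0`.
    have h0 : 0 ∉ s := fun h0 => h (prod_eq_zero h0 (by simp [ha]))
    obtain ⟨k, hk⟩ := MZVIndex.exists_toFinset_eq h0
    exact ⟨k, Subtype.ext hk⟩

lemma ofReal_esymmTsum {ι : Type*} (b : ι → ℝ) (n : ℕ) :
    ((esymmTsum b n : ℝ) : ℂ) = esymmTsum (fun i => (b i : ℂ)) n := by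
  simp [esymmTsum, Complex.ofReal_tsum]

lemma coeff_eq_of_hasSum_pow {c d : ℕ → ℂ} {f : ℂ → ℂ}
    (hc : ∀ z, HasSum (fun n => z ^ n * c n) (f z))
    (hd : ∀ z, HasSum (fun n => z ^ n * d n) (f z)) : c = d := by
  have key : ∀ {c : ℕ → ℂ}, (∀ z, HasSum (fun n => z ^ n * c n) (f z)) →
      HasFPowerSeriesAt f (FormalMultilinearSeries.ofScalars ℂ c) 0 := fun {c} h =>
    hasFPowerSeriesAt_iff.2 (Eventually.of_forall fun z => by
      simpa [FormalMultilinearSeries.coeff_ofScalars] using h z)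
  have h := (key hc).eq_formalMultilinearSeries (key hd)
  funext n
  simpa [FormalMultilinearSeries.coeff_ofScalars] using congrArg (fun p => p.coeff n) h

/-- The factorization of `1 - y ^ m` over the squares of the `m`-th roots of unity, `m` odd. -/
lemma prod_one_sub_sq_mul {m : ℕ} (hodd : Odd m) {w : ℂ} (hw : IsPrimitiveRoot w m) (y : ℂ) :
    ∏ j ∈ range m, (1 - (w ^ j) ^ 2 * y) = 1 - y ^ m := by
  have hm : 0 < m := hodd.pos
  -- Squaring permutes the `m`-th roots of unity because `m` is odd.
  have hw2 : IsPrimitiveRoot (w ^ 2) m :=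
    hw.pow_of_coprime 2 (Nat.coprime_two_left.2 hodd)
  have := hw2.pow_sub_pow_eq_prod_sub_mul 1 y hm
  rw [one_pow] at this
  rw [this]
  refine prod_nbij (fun j => (w ^ 2) ^ j) ?_ ?_ ?_ ?_
  · intro j _
    rw [Polynomial.mem_nthRootsFinset hm, ← pow_mul, mul_comm, pow_mul, hw2.pow_eq_one, one_pow]
  · intro i hi j hj h
    exact hw2.pow_inj (by simpa using hi) (by simpa using hj) h
  · intro z hz
    rw [Finset.mem_coe, Polynomial.mem_nthRootsFinset hm] at hz
    have : NeZero m := ⟨hm.ne'⟩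
    obtain ⟨i, hi, h⟩ := hw2.eq_pow_of_pow_eq_one hz
    exact ⟨i, by simpa using hi, h⟩
  · intro j _
    ring

lemma prod_pow_range_primitiveRoot {m : ℕ} (hodd : Odd m) {w : ℂ} (hw : IsPrimitiveRoot w m) :
    ∏ j ∈ range m, w ^ j = 1 := by
  obtain ⟨k, rfl⟩ := hodd
  rw [prod_pow_eq_pow_sum, sum_range_id]
  have : (2 * k + 1) * (2 * k + 1 - 1) / 2 = (2 * k + 1) * k := by
    rw [Nat.add_sub_cancel, show (2 * k + 1) * (2 * k) = 2 * ((2 * k + 1) * k) by ring]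
    simp
  rw [this, pow_mul, hw.pow_eq_one, one_pow]

lemma prod_sin_eq_mul_tprod {m : ℕ} (hm : 2 ≤ m) (hodd : Odd m) {w : ℂ} (hw : IsPrimitiveRoot w m)
    (x : ℂ) :
    ∏ j ∈ range m, Complex.sin (Real.pi * (w ^ j * x)) =
      (Real.pi * x) ^ m * ∏' i : ℕ, (1 + -x ^ (2 * m) * ((i : ℂ) ^ (2 * m))⁻¹) := by
  have hb : Summable fun i : ℕ => ‖((i : ℂ) ^ (2 * m))⁻¹‖ := by
    simpa using summable_inv_pow_norm (a := 2 * m) (by omega)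
  -- The shift by one absorbs the trivial factor at `i = 0`; Euler's factors are indexed by `i + 1`.
  have h1 := ((tendsto_prod_one_add_mul hb (-x ^ (2 * m))).comp
    (tendsto_add_atTop_nat 1)).const_mul ((Real.pi * x) ^ m)
  have h2 := tendsto_finsetProd (range m)
    fun j _ => Complex.tendsto_euler_sin_prod (w ^ j * x)
  refine tendsto_nhds_unique h2 (h1.congr fun N => ?_)
  simp only [Function.comp_apply]
  rw [prod_mul_distrib, prod_comm (s := range m), prod_range_succ']
  have hc : ∏ j ∈ range m, ((Real.pi : ℂ) * (w ^ j * x)) = (Real.pi * x) ^ m := by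
    simp_rw [mul_left_comm (Real.pi : ℂ) (w ^ _) x]
    rw [prod_mul_distrib, prod_pow_range_primitiveRoot hodd hw, prod_const, card_range, one_mul]
  rw [hc]
  have h0 : (2 * m) ≠ 0 := by omega
  simp only [Nat.cast_zero, zero_pow h0, inv_zero, mul_zero, add_zero, mul_one]
  congr 1
  refine prod_congr rfl fun i _ => ?_
  have hi : ((i : ℂ) + 1) ≠ 0 := by exact_mod_cast Nat.succ_ne_zero i
  have := prod_one_sub_sq_mul hodd hw (x ^ 2 / ((i : ℂ) + 1) ^ 2)
  rw [div_pow, ← pow_mul, ← pow_mul] at this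
  push_cast
  rw [neg_mul, ← sub_eq_add_neg, ← div_eq_mul_inv, ← this]
  refine prod_congr rfl fun j _ => ?_
  ring

lemma prod_sin_eq_sum_exp {m : ℕ} (hm : 2 ≤ m) {w : ℂ} (hw : IsPrimitiveRoot w m) (x : ℂ) :
    (2 * Complex.I) ^ m * ∏ j ∈ range m, Complex.sin (Real.pi * (w ^ j * x)) =
      ∑ s ∈ (range m).powerset, (-1) ^ (m - s.card) *
        Complex.exp (2 * Real.pi * Complex.I * (∑ j ∈ s, w ^ j) * x) := by
  have hsin : ∀ z : ℂ, 2 * Complex.I * Complex.sin z =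
      Complex.exp (z * Complex.I) + -Complex.exp (-(z * Complex.I)) := by
    intro z
    rw [Complex.sin, neg_mul]
    linear_combination (Complex.exp (-(z * Complex.I)) - Complex.exp (z * Complex.I)) * Complex.I_sq
  have h : (2 * Complex.I) ^ m = ∏ _j ∈ range m, (2 * Complex.I) := by simp
  rw [h, ← prod_mul_distrib]
  simp_rw [hsin]
  rw [prod_add]
  refine sum_congr rfl fun s hs => ?_
  rw [mem_powerset] at hs
  rw [prod_neg, card_sdiff_of_subset hs, card_range, mul_left_comm, ← Complex.exp_sum,
    ← Complex.exp_sum, ← Complex.exp_add]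
  congr 2
  -- The complement of `s` has root sum opposite to that of `s`, so the difference of the two is
  -- twice the sum over `s`.
  have hz : ∑ j ∈ range m, w ^ j = 0 := hw.geom_sum_eq_zero (by omega)
  rw [← sum_sdiff hs] at hz
  have h3 : ∀ u : Finset ℕ, ∑ i ∈ u, (Real.pi : ℂ) * (w ^ i * x) * Complex.I =
      Real.pi * x * Complex.I * ∑ i ∈ u, w ^ i := fun u => by
    rw [mul_sum]
    exact sum_congr rfl fun i _ => by ring
  rw [sum_neg_distrib, h3, h3]
  linear_combination -(Real.pi * x * Complex.I) * hz

lemma hasSum_pow_sum_mul_exp {ι : Type*} (S : Finset ι) (ε c : ι → ℂ) (x : ℂ) :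
    HasSum (fun k : ℕ => x ^ k * ((∑ s ∈ S, ε s * c s ^ k) / (k.factorial : ℂ)))
      (∑ s ∈ S, ε s * Complex.exp (c s * x)) := by
  have h : ∀ s ∈ S, HasSum (fun k : ℕ => ε s * ((c s * x) ^ k / (k.factorial : ℂ)))
      (ε s * Complex.exp (c s * x)) := fun s _ => by
    rw [Complex.exp_eq_exp_ℂ]
    exact (NormedSpace.expSeries_div_hasSum_exp (c s * x)).mul_left _
  refine (hasSum_sum h).congr_fun fun k => ?_
  rw [sum_div, mul_sum]
  exact sum_congr rfl fun s _ => by ring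

lemma multiZeta_const_eq_sum_powerset {m : ℕ} (hm : 2 ≤ m) (hodd : Odd m) {w : ℂ}
    (hw : IsPrimitiveRoot w m) (n : ℕ) :
    ((multiZeta (fun _ : Fin n => 2 * m) : ℝ) : ℂ) =
      (2 * Real.pi : ℂ) ^ (2 * m * n) / ((2 * m * n + m).factorial : ℂ) *
        ∑ s ∈ (range m).powerset, (-1) ^ (m - s.card) * (∑ j ∈ s, w ^ j) ^ (2 * m * n + m) := by
  set b : ℕ → ℂ := fun i => ((i : ℂ) ^ (2 * m))⁻¹ with hbdef
  have hb : Summable fun i => ‖b i‖ := by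
    simpa [b] using summable_inv_pow_norm (a := 2 * m) (by omega)
  have hz : ((multiZeta (fun _ : Fin n => 2 * m) : ℝ) : ℂ) = esymmTsum b n := by
    rw [multiZeta_const (by omega), ofReal_esymmTsum]
    simp [b]
  let g : ℕ → ℕ := fun k => 2 * m * k + m
  have hg : Function.Injective g := fun k l h => by
    have : 2 * m * k = 2 * m * l := by simpa [g] using h
    exact Nat.eq_of_mul_eq_mul_left (by omega) this
  -- Only exponents `2mk + m` occur on the product side; all other coefficients are zero.
  let c : ℕ → ℂ := Function.extend g
    (fun k => (2 * Complex.I * Real.pi) ^ m * ((-1) ^ k * esymmTsum b k)) 0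
  have hcd := coeff_eq_of_hasSum_pow (c := c) (f := fun x => (2 * Complex.I) ^ m *
      ∏ j ∈ range m, Complex.sin (Real.pi * (w ^ j * x))) (fun x => by
    rw [prod_sin_eq_mul_tprod hm hodd hw]
    have h := (hasSum_pow_mul_esymmTsum hb (-x ^ (2 * m))).mul_left
      ((2 * Complex.I) ^ m * (Real.pi * x) ^ m)
    rw [← mul_assoc]
    rw [← hg.hasSum_iff (fun k hk => by
      rw [show c k = 0 from Function.extend_apply' _ _ _ hk, mul_zero])]
    refine h.congr_fun fun k => ?_
    simp only [Function.comp_apply, c, hg.extend_apply, g]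
    rw [neg_pow (x ^ (2 * m)), ← pow_mul x]
    ring) (fun x => by
    rw [prod_sin_eq_sum_exp hm hw]
    exact hasSum_pow_sum_mul_exp _ _ _ x)
  have h := congrFun hcd (g n)
  simp only [c, hg.extend_apply, g] at h
  rw [hz]
  -- The sign `(-1)^n` of the product side cancels against this part of `(2πi)^(2mn+m)`.
  have hI : Complex.I ^ (2 * m * n) = (-1) ^ n := by
    rw [mul_assoc, pow_mul, Complex.I_sq, pow_mul, hodd.neg_one_pow]
  have h1 : ((-1 : ℂ) ^ n) ≠ 0 := by simp
  have hne : (2 * Complex.I * Real.pi : ℂ) ^ m ≠ 0 := by simp [Real.pi_ne_zero]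
  refine mul_left_cancel₀ h1 (mul_left_cancel₀ hne (h.trans ?_))
  rw [← hI]
  simp_rw [mul_pow _ (∑ j ∈ _, w ^ j), mul_left_comm ((-1 : ℂ) ^ _)]
  rw [← mul_sum]
  ring

/-- Sums over subsets invariant under complementation, for a set of odd size. -/
lemma sum_powerset_eq_two_mul {m : ℕ} (hodd : Odd m) {F : Finset ℕ → ℂ}
    (hF : ∀ s ∈ (range m).powerset, F (range m \ s) = F s) :
    ∑ s ∈ (range m).powerset, F s =
      2 * ∑ r ∈ range ((m - 1) / 2 + 1), ∑ s ∈ powersetCard r (range m), F s := by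
  obtain ⟨k, rfl⟩ := hodd
  rw [sum_powerset, card_range, show (2 * k + 1 - 1) / 2 = k by omega,
    show 2 * k + 1 + 1 = (k + 1) + (k + 1) by ring, sum_range_add,
    two_mul (∑ r ∈ range (k + 1), _)]
  congr 1
  -- Size `k + 1 + r` is paired with the complementary size `k - r`.
  rw [← sum_range_reflect (fun r => ∑ s ∈ powersetCard r (range (2 * k + 1)), F s) (k + 1)]
  refine sum_congr rfl fun r hr => ?_
  rw [mem_range] at hr
  refine sum_nbij' (fun s => range (2 * k + 1) \ s) (fun s => range (2 * k + 1) \ s) ?_ ?_ ?_ ?_ ?_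
  · intro s hs
    rw [mem_powersetCard] at hs ⊢
    refine ⟨sdiff_subset, ?_⟩
    rw [card_sdiff_of_subset hs.1, hs.2, card_range]
    omega
  · intro s hs
    rw [mem_powersetCard] at hs ⊢
    refine ⟨sdiff_subset, ?_⟩
    rw [card_sdiff_of_subset hs.1, hs.2, card_range]
    omega
  · intro s hs
    exact Finset.sdiff_sdiff_eq_self (mem_powersetCard.1 hs).1
  · intro s hs
    exact Finset.sdiff_sdiff_eq_self (mem_powersetCard.1 hs).1
  · intro s hs
    exact (hF s (mem_powerset.2 (mem_powersetCard.1 hs).1)).symm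

theorem theorem1 (m n : ℕ) (hm : 3 ≤ m) (hodd : Odd m) (hn : 1 ≤ n) (w : ℂ)
    (hw : w = Complex.exp (2 * (Real.pi : ℂ) * Complex.I / (m : ℂ))) :
    Summable (mzvTerm (fun _ : Fin n => 2 * m)) ∧
      ((multiZeta (fun _ : Fin n => 2 * m) : ℝ) : ℂ) =
        2 * (2 * (Real.pi : ℂ)) ^ (2 * m * n) / ((Nat.factorial (2 * m * n + m) : ℕ) : ℂ) *
          ∑ r ∈ Finset.Icc 1 ((m - 1) / 2), (-1 : ℂ) ^ (r - 1) *
            ∑ J ∈ Finset.powersetCard r (Finset.range m),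
              (∑ j ∈ J, w ^ j) ^ (2 * m * n + m) := by
  have hprim : IsPrimitiveRoot w m := hw ▸ Complex.isPrimitiveRoot_exp m (by omega)
  refine ⟨summable_mzvTerm_const (by omega) n, ?_⟩
  have hodd' : Odd (2 * m * n + m) := by
    rw [mul_assoc]
    exact (even_two_mul _).add_odd hodd
  rw [multiZeta_const_eq_sum_powerset (by omega) hodd hprim, sum_powerset_eq_two_mul hodd,
    sum_range_succ']
  -- The empty subset contributes a positive power of zero.
  · have h0 : ∑ s ∈ powersetCard 0 (range m),
        (-1 : ℂ) ^ (m - s.card) * (∑ j ∈ s, w ^ j) ^ (2 * m * n + m) = 0 := by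
      simp [show m ≠ 0 by omega]
    rw [h0, add_zero, range_eq_Ico, sum_Ico_add' (fun r => ∑ s ∈ powersetCard r (range m),
        (-1 : ℂ) ^ (m - s.card) * (∑ j ∈ s, w ^ j) ^ (2 * m * n + m)) 0 ((m - 1) / 2) 1,
      zero_add, Ico_add_one_right_eq_Icc]
    have hr : ∀ r ∈ Icc 1 ((m - 1) / 2), ∑ s ∈ powersetCard r (range m),
        (-1 : ℂ) ^ (m - s.card) * (∑ j ∈ s, w ^ j) ^ (2 * m * n + m) =
        (-1 : ℂ) ^ (r - 1) * ∑ J ∈ powersetCard r (range m),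
          (∑ j ∈ J, w ^ j) ^ (2 * m * n + m) := fun r hr => by
      rw [mul_sum]
      refine sum_congr rfl fun s hs => ?_
      rw [(mem_powersetCard.1 hs).2]
      congr 1
      rw [mem_Icc] at hr
      obtain ⟨k, rfl⟩ := hodd
      refine neg_one_pow_congr ?_
      rw [Nat.even_iff, Nat.even_iff]
      omega
    rw [sum_congr rfl hr]
    ring
  · intro s hs
    rw [mem_powerset] at hs
    have hz : ∑ j ∈ range m, w ^ j = 0 := hprim.geom_sum_eq_zero (by omega)
    rw [← sum_sdiff hs] at hz
    have hc : s.card ≤ m := by simpa using card_le_card hs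
    -- Complementation flips two signs: that of the odd power, and that of `(-1)^(m - s.card)` since
    -- `m` is odd.
    rw [eq_neg_of_add_eq_zero_left hz, hodd'.neg_pow, card_sdiff_of_subset hs, card_range,
      Nat.sub_sub_self hc, mul_neg, ← neg_mul]
    congr 1
    obtain ⟨d, hd⟩ := Nat.exists_eq_add_of_le hc
    rw [hd, Nat.add_sub_cancel_left]
    rw [hd] at hodd
    have h1 : (-1 : ℂ) ^ (s.card + d) = -1 := hodd.neg_one_pow
    rw [pow_add] at h1
    have h2 : (-1 : ℂ) ^ d * (-1 : ℂ) ^ d = 1 := by rw [← mul_pow]; simp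
    linear_combination (-(-1 : ℂ) ^ d) * h1 + (-1 : ℂ) ^ s.card * h2
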